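/- A binary-input channel $W\colon\{0,1\}\to\mathcal{Y}$ is given by transition probabilities $W(y\mid x)$, i.e. for each $x\in\{0,1\}$ a probability mass function on $\mathcal{Y}$ or, more generally, a probability density on a measurable space $\mathcal{Y}$ with respect to a $\sigma$-finite reference measure $dy$. Its symmetric capacity is the mutual information in bits between a uniform input and the output, $$I(W)=\sum_{x\in\{0,1\}}\int_{\mathcal{Y}} \tfrac12 W(y\mid x)\log_2\frac{W(y\mid x)}{\tfrac12 W(y\mid 0)+\tfrac12 W(y\mid 1)}\,dy .$$ Given two binary-input channels $W\colon\{0,1\}\to\mathcal{Y}$ and $V\colon\{0,1\}\to\mathcal{Z}$, define the binary-input channels $(W,V)^-$, with output alphabet $\mathcal{Y}\times\mathcal{Z}$, and $(W,V)^+$, with output alphabet $\mathcal{Y}\times\mathcal{Z}\times\{0,1\}$, by $$(W,V)^-(y,z\mid x)=\sum_{u\in\{0,1\}}\tfrac12 W(y\mid u+x)V(z\mid u),\qquad (W,V)^+(y,z,u\mid x)=\tfrac12 W(y\mid u+x)V(z\mid x),$$ where $+$ on $\{0,1\}$ is addition modulo 2 (and the reference measures on the output alphabets are the product measures, with counting measure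 on $\{0,1\}$). Let $W$ be any binary-input channel, and define channels $L_n,R_n$ by $L_0=R_0=W$ and $$L_{n+1}=(L_n,R_n)^-,\qquad R_{n+1}=(L_n,R_n)^+,\qquad n=0,1,2,\dots$$ Then the sequences $I(L_n)$ and $I(R_n)$ converge, and: (i) if $I(W)\ge 1/2$, then $\lim_{n\to\infty} I(L_n)=2I(W)-1$ and $\lim_{n\to\infty} I(R_n)=1$; (ii) if $I(W)\le 1/2$, then $\lim_{n\to\infty} I(L_n)=0$ and $\lim_{n\to\infty} I(R_n)=2I(W)$. -/

import Mathlib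

open MeasureTheory Filter Topology

universe u

/-- A binary-input (memoryless) channel `x ↦ W(· | x)` with input alphabet `{0,1} = ZMod 2`,
where `+` is addition modulo 2. The output alphabet `Y` is an arbitrary measurable space with a
σ-finite reference measure `ref`, and `W(· | x) = prob x` is a probability density with respect
to `ref`. Discrete alphabets are the case of the counting measure, where `W(· | x)` is a
probability mass function. Any two probability measures on a measurable space are of this form
(with `ref` their sum), so this covers all binary-input channels. -/
structure BinaryChannel where
  /-- output alphabet -/
  Y : Type u
  /-- σ-algebra on the output alphabet -/
  [mY : MeasurableSpace Y]
  /-- reference measure -/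
  ref : Measure Y
  [sigmaFinite_ref : SigmaFinite ref]
  /-- transition probabilities (densities): `prob x y` is `W(y | x)` -/
  prob : ZMod 2 → Y → ℝ
  measurable_prob : ∀ x, Measurable (prob x)
  prob_nonneg : ∀ x y, 0 ≤ prob x y
  integral_prob : ∀ x, ∫ y, prob x y ∂ref = 1

namespace BinaryChannel

attribute [instance] BinaryChannel.mY BinaryChannel.sigmaFinite_ref

theorem sum_zmod_two (f : ZMod 2 → ℝ) : ∑ u, f u = f 0 + f 1 := Fin.sum_univ_two f

theorem integrable_prob (W : BinaryChannel.{u}) (x : ZMod 2) : Integrable (W.prob x) W.ref := by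
  by_contra h
  have h1 := W.integral_prob x
  rw [integral_undef h] at h1
  exact zero_ne_one h1

/-- The symmetric capacity in bits: the mutual information between a uniform input and the
corresponding output,
`I(W) = ∑ₓ ∫ ½ W(y|x) log₂ (W(y|x) / (½ W(y|0) + ½ W(y|1))) dy`. -/
noncomputable def symCapacity (W : BinaryChannel.{u}) : ℝ :=
  ∑ x : ZMod 2, ∫ y, (1 / 2 : ℝ) * W.prob x y *
    Real.logb 2 (W.prob x y / ((1 / 2 : ℝ) * W.prob 0 y + (1 / 2 : ℝ) * W.prob 1 y)) ∂W.ref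

/-- `(W,V)⁻(y,z|x) = ∑ᵤ ½ W(y|u+x) V(z|u)`. -/
noncomputable def minus (W V : BinaryChannel.{u}) : BinaryChannel.{u} where
  Y := W.Y × V.Y
  ref := W.ref.prod V.ref
  prob x yz := ∑ u : ZMod 2, (1 / 2 : ℝ) * W.prob (u + x) yz.1 * V.prob u yz.2
  measurable_prob x := by
    refine Finset.measurable_sum _ fun u _ => ?_
    exact (((W.measurable_prob _).comp measurable_fst).const_mul _).mul
      ((V.measurable_prob _).comp measurable_snd)
  prob_nonneg x yz := by
    refine Finset.sum_nonneg fun u _ => ?_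
    exact mul_nonneg (mul_nonneg (by norm_num) (W.prob_nonneg _ _)) (V.prob_nonneg _ _)
  integral_prob x := by
    rw [integral_finsetSum]
    · have h : ∀ u : ZMod 2, ∫ yz : W.Y × V.Y, (1 / 2 : ℝ) * W.prob (u + x) yz.1 * V.prob u yz.2
          ∂(W.ref.prod V.ref) = 1 / 2 := by
        intro u
        simp only [mul_assoc]
        rw [integral_const_mul, integral_prod_mul, W.integral_prob, V.integral_prob]
        norm_num
      rw [sum_zmod_two, h, h]
      norm_num
    · intro u _
      simp only [mul_assoc]
      exact ((W.integrable_prob _).mul_prod (V.integrable_prob _)).const_mul _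

/-- `(W,V)⁺(y,z,u|x) = ½ W(y|u+x) V(z|x)`. -/
noncomputable def plus (W V : BinaryChannel.{u}) : BinaryChannel.{u} where
  Y := W.Y × V.Y × ZMod 2
  ref := W.ref.prod (V.ref.prod Measure.count)
  prob x yzu := (1 / 2 : ℝ) * W.prob (yzu.2.2 + x) yzu.1 * V.prob x yzu.2.1
  measurable_prob x := by
    have hW : Measurable fun p : W.Y × ZMod 2 => W.prob (p.2 + x) p.1 :=
      measurable_from_prod_countable_left fun u => W.measurable_prob (u + x)
    exact ((hW.comp (measurable_fst.prodMk (measurable_snd.comp measurable_snd))).const_mul _).mul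
      ((V.measurable_prob x).comp (measurable_fst.comp measurable_snd))
  prob_nonneg x yzu :=
    mul_nonneg (mul_nonneg (by norm_num) (W.prob_nonneg _ _)) (V.prob_nonneg _ _)
  integral_prob x := by
    have hdec : (fun yzu : W.Y × V.Y × ZMod 2 =>
        (1 / 2 : ℝ) * W.prob (yzu.2.2 + x) yzu.1 * V.prob x yzu.2.1) = fun yzu =>
        ∑ u : ZMod 2, (1 / 2 : ℝ) * (W.prob (u + x) yzu.1 *
          (V.prob x yzu.2.1 * if yzu.2.2 = u then 1 else 0)) := by
      funext yzu
      simp [mul_assoc]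
    have hind : ∀ u : ZMod 2,
        Integrable (fun v : ZMod 2 => if v = u then (1 : ℝ) else 0) Measure.count :=
      fun u => Integrable.of_finite
    have hindint : ∀ u : ZMod 2,
        ∫ v : ZMod 2, (if v = u then (1 : ℝ) else 0) ∂Measure.count = 1 := by
      intro u
      rw [integral_fintype (hind u)]
      simp
    have hterm : ∀ u : ZMod 2, ∫ yzu : W.Y × V.Y × ZMod 2, (1 / 2 : ℝ) * (W.prob (u + x) yzu.1 *
        (V.prob x yzu.2.1 * if yzu.2.2 = u then 1 else 0))
        ∂(W.ref.prod (V.ref.prod Measure.count)) = 1 / 2 := by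
      intro u
      rw [integral_const_mul,
        integral_prod_mul (W.prob (u + x))
          (fun zv : V.Y × ZMod 2 => V.prob x zv.1 * if zv.2 = u then 1 else 0),
        integral_prod_mul (V.prob x) (fun v : ZMod 2 => if v = u then 1 else 0),
        W.integral_prob, V.integral_prob, hindint]
      norm_num
    rw [hdec, integral_finsetSum]
    · rw [sum_zmod_two, hterm, hterm]
      norm_num
    · intro u _
      exact ((W.integrable_prob _).mul_prod
        ((V.integrable_prob x).mul_prod (hind u))).const_mul _

/-- The pair `(L_n, R_n)` of channels at level `n` of slow polarization:
`L_0 = R_0 = W`, `L_{n+1} = (L_n,R_n)⁻`, `R_{n+1} = (L_n,R_n)⁺`. -/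
noncomputable def slow (W : BinaryChannel.{u}) : ℕ → BinaryChannel.{u} × BinaryChannel.{u}
  | 0 => (W, W)
  | n + 1 => (minus (slow W n).1 (slow W n).2, plus (slow W n).1 (slow W n).2)

/-- The channel `L_n` of slow polarization started from `W`. -/
noncomputable def slowL (W : BinaryChannel.{u}) (n : ℕ) : BinaryChannel.{u} := (slow W n).1

/-- The channel `R_n` of slow polarization started from `W`. -/
noncomputable def slowR (W : BinaryChannel.{u}) (n : ℕ) : BinaryChannel.{u} := (slow W n).2

end BinaryChannel

/-!
The mutual information is the integral of a density `F(a, b)` of the two transition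
probabilities, which is homogeneous of degree one and satisfies `0 ≤ F(a, b) ≤ (a + b) / 2`.

* The chain rule for the two transforms is a pointwise identity between such densities, so that
  `I((W,V)⁻) + I((W,V)⁺) = I(W) + I(V)`. Hence `I(L_n) + I(R_n) = 2 I(W)` for all `n`.
* Convexity of `x log x` gives `F(a + c, b + c) ≤ F(a, b)`. Up to swapping the inputs of `W`,
  the pair of transition probabilities of `(W,V)⁻` is
  `½|V(z|0) - V(z|1)| • (W(y|0), W(y|1))` plus a constant pair, so that `I((W,V)⁻) ≤ I(W) T(V)`
  where `T(V) = ½ ∫ |V(z|0) - V(z|1)| dz` is the total variation distance.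
* The equivocation `1 - I(V)` is bounded by the Bhattacharyya integral `∫ √(V(z|0) V(z|1)) dz`,
  which in turn is small when `T(V)` is close to `1`. Quantitatively,
  `T(V) ≤ 1 - ½ (log 2)² (1 - I(V))²`.

It follows that `I(L_n)` decreases to some `l ≥ 0`, that `I(R_n)` converges to `r = 2 I(W) - l ≤ 1`,
and, on letting `n → ∞` in `I(L_{n+1}) ≤ I(L_n) (1 - ½ (log 2)² (1 - I(R_n))²)`, that
`l (1 - r)² ≤ 0`. So `l = 0` or `r = 1`, and `l + r = 2 I(W)` determines both limits.
-/

namespace BinaryChannel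

/-! ### The density of the symmetric capacity -/

/-- The integrand of the symmetric capacity, in bits, at an output with transition probabilities
`a` and `b`, both inputs being summed. It is `0` at `a = b = 0`. -/
noncomputable def capDensity (a b : ℝ) : ℝ :=
  (1 / 2 : ℝ) * a * Real.logb 2 (a / ((1 / 2 : ℝ) * a + (1 / 2 : ℝ) * b)) +
    (1 / 2 : ℝ) * b * Real.logb 2 (b / ((1 / 2 : ℝ) * a + (1 / 2 : ℝ) * b))

theorem capDensity_comm (a b : ℝ) : capDensity a b = capDensity b a := by
  unfold capDensity
  rw [add_comm ((1 / 2 : ℝ) * a) ((1 / 2 : ℝ) * b), add_comm]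

theorem capDensity_mul (t a b : ℝ) : capDensity (t * a) (t * b) = t * capDensity a b := by
  rcases eq_or_ne t 0 with rfl | ht
  · simp [capDensity]
  unfold capDensity
  have h : (1 / 2 : ℝ) * (t * a) + (1 / 2 : ℝ) * (t * b)
      = t * ((1 / 2 : ℝ) * a + (1 / 2 : ℝ) * b) := by ring
  rw [h, mul_div_mul_left _ _ ht, mul_div_mul_left _ _ ht]
  ring

/-- Upper bound for one term of the density, where `q` is the mean of the two transition
probabilities, so that `a / q ≤ 2`. -/
theorem mul_logb_div_le {a q : ℝ} (ha : 0 ≤ a) (hq : a ≤ 2 * q) : a * Real.logb 2 (a / q) ≤ a := by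
  rcases ha.eq_or_lt with rfl | ha
  · simp
  have hq0 : 0 < q := by linarith
  have h : Real.logb 2 (a / q) ≤ 1 := by
    rw [Real.logb_le_iff_le_rpow (by norm_num) (by positivity), Real.rpow_one]
    exact (div_le_iff₀ hq0).2 hq
  nlinarith

theorem le_mul_logb_div {a q : ℝ} (ha : 0 ≤ a) (hq : a ≤ 2 * q) :
    (a - q) / Real.log 2 ≤ a * Real.logb 2 (a / q) := by
  have h2 : 0 < Real.log 2 := Real.log_pos (by norm_num)
  rw [Real.logb, ← mul_div_assoc, div_le_div_iff_of_pos_right h2]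
  rcases ha.eq_or_lt with rfl | ha
  · simp; linarith
  have hq0 : 0 < q := by linarith
  have h := Real.one_sub_inv_le_log_of_pos (div_pos ha hq0)
  have h' : a * (1 - (a / q)⁻¹) = a - q := by field_simp
  nlinarith

theorem capDensity_nonneg {a b : ℝ} (ha : 0 ≤ a) (hb : 0 ≤ b) : 0 ≤ capDensity a b := by
  have h1 := le_mul_logb_div ha (q := (1 / 2 : ℝ) * a + (1 / 2 : ℝ) * b) (by linarith)
  have h2 := le_mul_logb_div hb (q := (1 / 2 : ℝ) * a + (1 / 2 : ℝ) * b) (by linarith)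
  have h3 : (a - ((1 / 2 : ℝ) * a + (1 / 2 : ℝ) * b)) / Real.log 2 +
    (b - ((1 / 2 : ℝ) * a + (1 / 2 : ℝ) * b)) / Real.log 2 = 0 := by ring
  unfold capDensity
  linarith

theorem capDensity_le {a b : ℝ} (ha : 0 ≤ a) (hb : 0 ≤ b) : capDensity a b ≤ (a + b) / 2 := by
  have h1 := mul_logb_div_le ha (q := (1 / 2 : ℝ) * a + (1 / 2 : ℝ) * b) (by linarith)
  have h2 := mul_logb_div_le hb (q := (1 / 2 : ℝ) * a + (1 / 2 : ℝ) * b) (by linarith)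
  unfold capDensity
  linarith

/-- Adding a useless observation of weight `c` does not increase one term of the density
(log-sum inequality). -/
theorem add_mul_log_div_le {a q c : ℝ} (ha : 0 ≤ a) (hq : 0 < q) (hc : 0 ≤ c) :
    (a + c) * Real.log ((a + c) / (q + c)) ≤ a * Real.log (a / q) := by
  have hqc : 0 < q + c := by linarith
  have h := Real.convexOn_mul_log.2 (Set.mem_Ici.2 (by positivity : 0 ≤ a / q))
    (Set.mem_Ici.2 zero_le_one) (by positivity : 0 ≤ q / (q + c))
    (by positivity : 0 ≤ c / (q + c)) (by field_simp)
  have e : q / (q + c) * (a / q) + c / (q + c) * 1 = (a + c) / (q + c) := by field_simp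
  simp only [smul_eq_mul, e, Real.log_one, mul_zero, add_zero] at h
  calc (a + c) * Real.log ((a + c) / (q + c))
      = (q + c) * ((a + c) / (q + c) * Real.log ((a + c) / (q + c))) := by field_simp
    _ ≤ (q + c) * (q / (q + c) * (a / q * Real.log (a / q))) := by gcongr
    _ = a * Real.log (a / q) := by field_simp

theorem capDensity_add_le {a b c : ℝ} (ha : 0 ≤ a) (hb : 0 ≤ b) (hc : 0 ≤ c) :
    capDensity (a + c) (b + c) ≤ capDensity a b := by
  have h2 : 0 < Real.log 2 := Real.log_pos (by norm_num)
  rcases (add_nonneg ha hb).eq_or_lt with h0 | h0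
  · have ha0 : a = 0 := by linarith
    have hb0 : b = 0 := by linarith
    subst ha0 hb0
    rcases eq_or_ne c 0 with rfl | hc0
    · simp
    · have e : (1 / 2 : ℝ) * c + (1 / 2 : ℝ) * c = c := by ring
      simp only [capDensity, zero_add, e, div_self hc0]
      simp
  have hq : 0 < (1 / 2 : ℝ) * a + (1 / 2 : ℝ) * b := by linarith
  have h1 := add_mul_log_div_le ha hq hc
  have h3 := add_mul_log_div_le hb hq hc
  have e : (1 / 2 : ℝ) * (a + c) + (1 / 2 : ℝ) * (b + c)
      = (1 / 2 : ℝ) * a + (1 / 2 : ℝ) * b + c := by ring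
  unfold capDensity Real.logb
  rw [e]
  have key : ∀ x y s t : ℝ, (1 / 2 : ℝ) * x * (s / Real.log 2) + (1 / 2 : ℝ) * y * (t / Real.log 2)
      = (x * s + y * t) / (2 * Real.log 2) := by
    intros; field_simp
  rw [key, key]
  gcongr

/-- The arguments on the left are the transition probabilities of `(W,V)⁻` for `w = W(y|·)` and
`v = V(z|·)`. For `v₁ ≤ v₀` they are `½ (v₀ - v₁) • (w₀, w₁)` plus the constant pair with value
`½ v₁ (w₀ + w₁)`. -/
theorem capDensity_minus_le {w₀ w₁ v₀ v₁ : ℝ} (hw₀ : 0 ≤ w₀) (hw₁ : 0 ≤ w₁) (hv₀ : 0 ≤ v₀)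
    (hv₁ : 0 ≤ v₁) :
    capDensity ((1 / 2 : ℝ) * w₀ * v₀ + (1 / 2 : ℝ) * w₁ * v₁)
      ((1 / 2 : ℝ) * w₁ * v₀ + (1 / 2 : ℝ) * w₀ * v₁) ≤ capDensity w₀ w₁ * (|v₀ - v₁| / 2) := by
  -- Swapping the values of `v` swaps the arguments of the density, so assume `v₁ ≤ v₀`.
  wlog h : v₁ ≤ v₀ generalizing v₀ v₁
  · have := this hv₁ hv₀ (le_of_not_ge h)
    rw [abs_sub_comm, capDensity_comm]
    convert this using 2 <;> ring
  rw [abs_of_nonneg (sub_nonneg.2 h)]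
  have h1 := capDensity_add_le (a := (v₀ - v₁) / 2 * w₀) (b := (v₀ - v₁) / 2 * w₁)
    (c := v₁ * (w₀ + w₁) / 2) (mul_nonneg (by linarith) hw₀) (mul_nonneg (by linarith) hw₁)
    (by positivity)
  rw [capDensity_mul, mul_comm ((v₀ - v₁) / 2) (capDensity _ _)] at h1
  convert h1 using 2 <;> ring

/-- A term of the density relative to the output probability `r` is split through an intermediate
value `p`. The value `p` is allowed to vanish only together with `a`. -/
theorem mul_logb_div_split {a p r : ℝ} (hp : a ≠ 0 → p ≠ 0) (hr : a ≠ 0 → r ≠ 0) :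
    a * Real.logb 2 (a / r) = a * Real.logb 2 (a / p) + a * Real.logb 2 (p / r) := by
  rcases eq_or_ne a 0 with rfl | ha
  · simp
  rw [Real.logb_div ha (hr ha), Real.logb_div ha (hp ha), Real.logb_div (hp ha) (hr ha)]
  ring

theorem mul_mul_logb_mul_div_mul {a b p q : ℝ} (hp : a ≠ 0 → p ≠ 0) (hq : b ≠ 0 → q ≠ 0) :
    a * b * Real.logb 2 (a * b / (p * q))
      = a * b * Real.logb 2 (a / p) + a * b * Real.logb 2 (b / q) := by
  rcases eq_or_ne a 0 with rfl | ha
  · simp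
  rcases eq_or_ne b 0 with rfl | hb
  · simp
  rw [mul_div_mul_comm, Real.logb_mul (div_ne_zero ha (hp ha)) (div_ne_zero hb (hq hb))]
  ring

/-- The chain rule of mutual information for the two transforms, pointwise. -/
theorem capDensity_chain {w₀ w₁ v₀ v₁ : ℝ} (hw₀ : 0 ≤ w₀) (hw₁ : 0 ≤ w₁) (hv₀ : 0 ≤ v₀)
    (hv₁ : 0 ≤ v₁) :
    capDensity ((1 / 2 : ℝ) * w₀ * v₀ + (1 / 2 : ℝ) * w₁ * v₁)
        ((1 / 2 : ℝ) * w₁ * v₀ + (1 / 2 : ℝ) * w₀ * v₁) +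
      (capDensity ((1 / 2 : ℝ) * w₀ * v₀) ((1 / 2 : ℝ) * w₁ * v₁) +
        capDensity ((1 / 2 : ℝ) * w₁ * v₀) ((1 / 2 : ℝ) * w₀ * v₁)) =
      capDensity w₀ w₁ * ((v₀ + v₁) / 2) + (w₀ + w₁) / 2 * capDensity v₀ v₁ := by
  have h00 := mul_nonneg hw₀ hv₀
  have h01 := mul_nonneg hw₀ hv₁
  have h10 := mul_nonneg hw₁ hv₀
  have h11 := mul_nonneg hw₁ hv₁
  set q := (1 / 2 : ℝ) * w₀ + (1 / 2 : ℝ) * w₁ with hq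
  set r := (1 / 2 : ℝ) * v₀ + (1 / 2 : ℝ) * v₁ with hr
  set P := (1 / 2 : ℝ) * w₀ * v₀ + (1 / 2 : ℝ) * w₁ * v₁ with hP
  set N := (1 / 2 : ℝ) * w₁ * v₀ + (1 / 2 : ℝ) * w₀ * v₁ with hN
  have q0 : w₀ ≠ 0 → q ≠ 0 := fun h => by have := hw₀.lt_of_ne' h; positivity
  have q1 : w₁ ≠ 0 → q ≠ 0 := fun h => by have := hw₁.lt_of_ne' h; positivity
  have r0 : v₀ ≠ 0 → r ≠ 0 := fun h => by have := hv₀.lt_of_ne' h; positivity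
  have r1 : v₁ ≠ 0 → r ≠ 0 := fun h => by have := hv₁.lt_of_ne' h; positivity
  have P0 : w₀ * v₀ ≠ 0 → P ≠ 0 := fun h => by
    have := h00.lt_of_ne' h; simp only [hP, mul_assoc]; positivity
  have P1 : w₁ * v₁ ≠ 0 → P ≠ 0 := fun h => by
    have := h11.lt_of_ne' h; simp only [hP, mul_assoc]; positivity
  have N0 : w₁ * v₀ ≠ 0 → N ≠ 0 := fun h => by
    have := h10.lt_of_ne' h; simp only [hN, mul_assoc]; positivity
  have N1 : w₀ * v₁ ≠ 0 → N ≠ 0 := fun h => by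
    have := h01.lt_of_ne' h; simp only [hN, mul_assoc]; positivity
  have nz : ∀ {a b c d : ℝ}, (a ≠ 0 → c ≠ 0) → (b ≠ 0 → d ≠ 0) → a * b ≠ 0 → c * d ≠ 0 :=
    fun hc hd h => mul_ne_zero (hc (left_ne_zero_of_mul h)) (hd (right_ne_zero_of_mul h))
  -- Each of the four terms `w v log (w v / (q r))` is split along both sides of the identity.
  have s00 := (mul_logb_div_split P0 (nz q0 r0)).symm.trans (mul_mul_logb_mul_div_mul q0 r0)
  have s11 := (mul_logb_div_split P1 (nz q1 r1)).symm.trans (mul_mul_logb_mul_div_mul q1 r1)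
  have s10 := (mul_logb_div_split N0 (nz q1 r0)).symm.trans (mul_mul_logb_mul_div_mul q1 r0)
  have s01 := (mul_logb_div_split N1 (nz q0 r1)).symm.trans (mul_mul_logb_mul_div_mul q0 r1)
  have e : (1 / 2 : ℝ) * P + (1 / 2 : ℝ) * N = q * r := by simp only [hP, hN, hq, hr]; ring
  simp only [mul_assoc (1 / 2 : ℝ), capDensity_mul]
  unfold capDensity
  have eP : (1 / 2 : ℝ) * (w₀ * v₀) + (1 / 2 : ℝ) * (w₁ * v₁) = P := by simp only [hP]; ring
  have eN : (1 / 2 : ℝ) * (w₁ * v₀) + (1 / 2 : ℝ) * (w₀ * v₁) = N := by simp only [hN]; ring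
  rw [e, eP, eN, ← hq, ← hr]
  have fP : (1 / 2 : ℝ) * P * Real.logb 2 (P / (q * r))
      = (1 / 4 : ℝ) * (w₀ * v₀ * Real.logb 2 (P / (q * r)) +
        w₁ * v₁ * Real.logb 2 (P / (q * r))) := by
    rw [hP]; ring
  have fN : (1 / 2 : ℝ) * N * Real.logb 2 (N / (q * r))
      = (1 / 4 : ℝ) * (w₁ * v₀ * Real.logb 2 (N / (q * r)) +
        w₀ * v₁ * Real.logb 2 (N / (q * r))) := by
    rw [hN]; ring
  rw [fP, fN]
  linear_combination (1 / 4 : ℝ) * (s00 + s11 + s10 + s01)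

/-- The equivocation density is at most the Bhattacharyya density: with `log x ≤ 2 (√x - 1)` it is
at most `√(a + b) (√a + √b) - (a + b)`, and the product is bounded by the mean of the squares. -/
theorem equivocation_le_sqrt {a b : ℝ} (ha : 0 ≤ a) (hb : 0 ≤ b) :
    ((a + b) / 2 - capDensity a b) * Real.log 2 ≤ √a * √b := by
  have h2 : 0 < Real.log 2 := Real.log_pos (by norm_num)
  have term : ∀ x q : ℝ, 0 ≤ x → x ≤ 2 * q →
      x * Real.log 2 - x * Real.log (x / q) ≤ 2 * (√x * √(2 * q) - x) := by
    intro x q hx hxq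
    rcases hx.eq_or_lt with rfl | hx
    · simp
    have hq : 0 < q := by linarith
    have hlog : Real.log 2 - Real.log (x / q) = 2 * Real.log (√(2 * q) / √x) := by
      rw [← Real.sqrt_div (by positivity), Real.log_sqrt (by positivity),
        Real.log_div hx.ne' hq.ne', Real.log_div (by positivity) hx.ne',
        Real.log_mul (by norm_num) hq.ne']
      ring
    have hle := Real.log_le_sub_one_of_pos (x := √(2 * q) / √x) (by positivity)
    have hs : x * (√(2 * q) / √x - 1) = √x * √(2 * q) - x := by
      have := Real.mul_self_sqrt hx.le
      have hx' : √x ≠ 0 := by positivity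
      field_simp
      linear_combination (-√(2 * q)) * this
    rw [← mul_sub, hlog, ← hs]
    nlinarith
  have hq : 2 * ((1 / 2 : ℝ) * a + (1 / 2 : ℝ) * b) = a + b := by ring
  have ta := term a ((1 / 2 : ℝ) * a + (1 / 2 : ℝ) * b) ha (by linarith)
  have tb := term b ((1 / 2 : ℝ) * a + (1 / 2 : ℝ) * b) hb (by linarith)
  rw [hq] at ta tb
  have e : ((a + b) / 2 - capDensity a b) * Real.log 2 =
      ((a * Real.log 2 - a * Real.log (a / ((1 / 2 : ℝ) * a + (1 / 2 : ℝ) * b))) +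
      (b * Real.log 2 - b * Real.log (b / ((1 / 2 : ℝ) * a + (1 / 2 : ℝ) * b)))) / 2 := by
    unfold capDensity Real.logb
    field_simp
    ring
  rw [e]
  have sa := Real.sq_sqrt ha
  have sb := Real.sq_sqrt hb
  have sc := Real.sq_sqrt (add_nonneg ha hb)
  nlinarith [sq_nonneg (√a + √b - √(a + b))]

/-- With `√(a b) = √(max a b) √(min a b)`, the weighted mean inequality bounds the equivocation
density by the density of the total variation distance. -/
theorem equivocation_le_tv {a b ε : ℝ} (ha : 0 ≤ a) (hb : 0 ≤ b) (hε : 0 < ε) :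
    ((a + b) / 2 - capDensity a b) * Real.log 2 ≤
      ε * (a + b) / 2 + ((a + b) / 2 - |a - b| / 2) / (2 * ε) := by
  refine (equivocation_le_sqrt ha hb).trans ?_
  wlog h : b ≤ a generalizing a b
  · have := this hb ha (le_of_not_ge h)
    rw [abs_sub_comm, mul_comm, add_comm a b]
    exact this
  rw [abs_of_nonneg (sub_nonneg.2 h)]
  have e : (a + b) / 2 - (a - b) / 2 = b := by ring
  rw [e]
  have sa := Real.sq_sqrt ha
  have sb := Real.sq_sqrt hb
  have h1 : √a * √b ≤ ε * a / 2 + b / (2 * ε) := by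
    have h3 : ε * a / 2 + b / (2 * ε) - √a * √b = (ε * √a - √b) ^ 2 / (2 * ε) := by
      field_simp
      rw [sub_sq, mul_pow, sa, sb]
      ring
    have : 0 ≤ (ε * √a - √b) ^ 2 / (2 * ε) := by positivity
    linarith
  have : 0 ≤ ε * b := by positivity
  linarith

/-! ### Integral formulas for channels -/

theorem measurable_capDensity : Measurable fun p : ℝ × ℝ => capDensity p.1 p.2 := by
  unfold capDensity Real.logb
  fun_prop

theorem integrable_capDensity (W : BinaryChannel.{u}) :
    Integrable (fun y => capDensity (W.prob 0 y) (W.prob 1 y)) W.ref := by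
  refine Integrable.mono' (((W.integrable_prob 0).add (W.integrable_prob 1)).div_const 2)
    (measurable_capDensity.comp
      ((W.measurable_prob 0).prodMk (W.measurable_prob 1))).aestronglyMeasurable
    (Eventually.of_forall fun y => ?_)
  rw [Real.norm_eq_abs, abs_of_nonneg (capDensity_nonneg (W.prob_nonneg 0 y) (W.prob_nonneg 1 y))]
  exact capDensity_le (W.prob_nonneg 0 y) (W.prob_nonneg 1 y)

/-- The two integrals defining the symmetric capacity converge separately, so they can be merged. -/
theorem symCapacity_eq_integral (W : BinaryChannel.{u}) :
    W.symCapacity = ∫ y, capDensity (W.prob 0 y) (W.prob 1 y) ∂W.ref := by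
  have h2 : 0 < Real.log 2 := Real.log_pos (by norm_num)
  have hint : ∀ x, Integrable (fun y => (1 / 2 : ℝ) * W.prob x y *
      Real.logb 2 (W.prob x y / ((1 / 2 : ℝ) * W.prob 0 y + (1 / 2 : ℝ) * W.prob 1 y))) W.ref := by
    intro x
    simp only [mul_assoc (1 / 2 : ℝ) (W.prob x _)]
    refine Integrable.const_mul ?_ _
    have m0 := W.measurable_prob 0
    have m1 := W.measurable_prob 1
    have mx := W.measurable_prob x
    have hq : Integrable (fun y => (1 / 2 : ℝ) * W.prob 0 y + (1 / 2 : ℝ) * W.prob 1 y) W.ref :=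
      ((W.integrable_prob 0).const_mul _).add ((W.integrable_prob 1).const_mul _)
    refine Integrable.mono' ((W.integrable_prob x).add (hq.div_const (Real.log 2))) ?_
      (Eventually.of_forall fun y => ?_)
    · unfold Real.logb
      exact Measurable.aestronglyMeasurable (by fun_prop)
    · have p0 := W.prob_nonneg 0 y
      have p1 := W.prob_nonneg 1 y
      have px := W.prob_nonneg x y
      have hle : W.prob x y ≤ 2 * ((1 / 2 : ℝ) * W.prob 0 y + (1 / 2 : ℝ) * W.prob 1 y) := by
        fin_cases x
        · change W.prob 0 y ≤ _; linarith
        · change W.prob 1 y ≤ _; linarith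
      have u := mul_logb_div_le px hle
      have l := le_mul_logb_div px hle
      rw [sub_div] at l
      have : 0 ≤ W.prob x y / Real.log 2 := by positivity
      have : 0 ≤ ((1 / 2 : ℝ) * W.prob 0 y + (1 / 2 : ℝ) * W.prob 1 y) / Real.log 2 := by positivity
      simp only [Pi.add_apply]
      rw [Real.norm_eq_abs, abs_le]
      constructor <;> linarith
  rw [symCapacity, sum_zmod_two, ← integral_add (hint 0) (hint 1)]
  rfl

theorem symCapacity_nonneg (W : BinaryChannel.{u}) : 0 ≤ W.symCapacity := by
  rw [symCapacity_eq_integral]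
  exact integral_nonneg fun y => capDensity_nonneg (W.prob_nonneg 0 y) (W.prob_nonneg 1 y)

theorem integrable_mean (W : BinaryChannel.{u}) :
    Integrable (fun y => (W.prob 0 y + W.prob 1 y) / 2) W.ref :=
  ((W.integrable_prob 0).add (W.integrable_prob 1)).div_const 2

theorem integral_mean (W : BinaryChannel.{u}) :
    ∫ y, (W.prob 0 y + W.prob 1 y) / 2 ∂W.ref = 1 := by
  rw [integral_div, integral_add (W.integrable_prob 0) (W.integrable_prob 1), W.integral_prob,
    W.integral_prob]
  norm_num

theorem symCapacity_le_one (W : BinaryChannel.{u}) : W.symCapacity ≤ 1 := by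
  rw [symCapacity_eq_integral, ← W.integral_mean]
  exact integral_mono W.integrable_capDensity W.integrable_mean
    fun y => capDensity_le (W.prob_nonneg 0 y) (W.prob_nonneg 1 y)

/-- The total variation distance between the two output distributions of a channel. -/
noncomputable def tvDist (W : BinaryChannel.{u}) : ℝ :=
  ∫ y, |W.prob 0 y - W.prob 1 y| / 2 ∂W.ref

theorem integrable_tv (W : BinaryChannel.{u}) :
    Integrable (fun y => |W.prob 0 y - W.prob 1 y| / 2) W.ref :=
  ((W.integrable_prob 0).sub (W.integrable_prob 1)).abs.div_const 2

theorem tvDist_le_one (W : BinaryChannel.{u}) : W.tvDist ≤ 1 := by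
  rw [tvDist, ← W.integral_mean]
  refine integral_mono W.integrable_tv W.integrable_mean fun y => ?_
  have h0 := W.prob_nonneg 0 y
  have h1 := W.prob_nonneg 1 y
  have : |W.prob 0 y - W.prob 1 y| ≤ W.prob 0 y + W.prob 1 y :=
    abs_sub_le_iff.2 ⟨by linarith, by linarith⟩
  simp only
  linarith

/-- A channel that is not perfect has total variation distance bounded away from `1`. -/
theorem tvDist_le (W : BinaryChannel.{u}) :
    W.tvDist ≤ 1 - Real.log 2 ^ 2 / 2 * (1 - W.symCapacity) ^ 2 := by
  have h2 : 0 < Real.log 2 := Real.log_pos (by norm_num)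
  rcases W.symCapacity_le_one.eq_or_lt with h | h
  · rw [h]; simpa using W.tvDist_le_one
  have key : ∀ ε : ℝ, 0 < ε →
      (1 - W.symCapacity) * Real.log 2 ≤ ε + (1 - W.tvDist) / (2 * ε) := by
    intro ε hε
    have hm : ∫ y, ((W.prob 0 y + W.prob 1 y) / 2 - capDensity (W.prob 0 y) (W.prob 1 y)) *
          Real.log 2 ∂W.ref ≤
        ∫ y, (ε * ((W.prob 0 y + W.prob 1 y) / 2) + ((W.prob 0 y + W.prob 1 y) / 2 -
          |W.prob 0 y - W.prob 1 y| / 2) / (2 * ε)) ∂W.ref :=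
      integral_mono ((W.integrable_mean.sub W.integrable_capDensity).mul_const (Real.log 2))
        ((W.integrable_mean.const_mul ε).add ((W.integrable_mean.sub W.integrable_tv).div_const
          (2 * ε))) fun y => by
            have := equivocation_le_tv (W.prob_nonneg 0 y) (W.prob_nonneg 1 y) hε
            rw [mul_div_assoc] at this
            exact this
    rwa [integral_mul_const, integral_sub W.integrable_mean W.integrable_capDensity, integral_add
      (W.integrable_mean.const_mul ε) (by
        exact (W.integrable_mean.sub W.integrable_tv).div_const (2 * ε)), integral_const_mul,
      integral_div (2 * ε), integral_sub W.integrable_mean W.integrable_tv, W.integral_mean,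
      ← W.symCapacity_eq_integral, mul_one] at hm
  -- The bound is optimized by the value of `ε` for which it is half of the left-hand side.
  have hpos : 0 < (1 - W.symCapacity) * Real.log 2 := mul_pos (by linarith) h2
  have h3 := key ((1 - W.symCapacity) * Real.log 2 / 2) (by positivity)
  rw [mul_div_cancel₀ _ (two_ne_zero' ℝ)] at h3
  have h4 : (1 - W.symCapacity) * Real.log 2 / 2 ≤
      (1 - W.tvDist) / ((1 - W.symCapacity) * Real.log 2) := by linarith
  rw [le_div_iff₀ hpos] at h4
  nlinarith

/-! ### The two transforms -/

theorem minus_prob_zero (W V : BinaryChannel.{u}) (p : W.Y × V.Y) :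
    (minus W V).prob 0 p = (1 / 2 : ℝ) * W.prob 0 p.1 * V.prob 0 p.2 +
      (1 / 2 : ℝ) * W.prob 1 p.1 * V.prob 1 p.2 := by
  change ∑ u : ZMod 2, (1 / 2 : ℝ) * W.prob (u + 0) p.1 * V.prob u p.2 = _
  rw [sum_zmod_two, add_zero, add_zero]

theorem minus_prob_one (W V : BinaryChannel.{u}) (p : W.Y × V.Y) :
    (minus W V).prob 1 p = (1 / 2 : ℝ) * W.prob 1 p.1 * V.prob 0 p.2 +
      (1 / 2 : ℝ) * W.prob 0 p.1 * V.prob 1 p.2 := by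
  change ∑ u : ZMod 2, (1 / 2 : ℝ) * W.prob (u + 1) p.1 * V.prob u p.2 = _
  rw [sum_zmod_two, zero_add, show (1 + 1 : ZMod 2) = 0 from by decide]

/-- The density of the symmetric capacity of `(W,V)⁻` in terms of `W` and `V`. -/
noncomputable def minusDensity (W V : BinaryChannel.{u}) (p : W.Y × V.Y) : ℝ :=
  capDensity ((1 / 2 : ℝ) * W.prob 0 p.1 * V.prob 0 p.2 + (1 / 2 : ℝ) * W.prob 1 p.1 * V.prob 1 p.2)
    ((1 / 2 : ℝ) * W.prob 1 p.1 * V.prob 0 p.2 + (1 / 2 : ℝ) * W.prob 0 p.1 * V.prob 1 p.2)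

theorem capDensity_minus (W V : BinaryChannel.{u}) (p : W.Y × V.Y) :
    capDensity ((minus W V).prob 0 p) ((minus W V).prob 1 p) = minusDensity W V p :=
  congrArg₂ capDensity (minus_prob_zero W V p) (minus_prob_one W V p)

theorem integrable_minusDensity (W V : BinaryChannel.{u}) :
    Integrable (minusDensity W V) (W.ref.prod V.ref) :=
  (minus W V).integrable_capDensity.congr (Eventually.of_forall (capDensity_minus W V))

theorem symCapacity_minus (W V : BinaryChannel.{u}) :
    (minus W V).symCapacity = ∫ p, minusDensity W V p ∂(W.ref.prod V.ref) :=
  (symCapacity_eq_integral _).trans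
    (integral_congr_ae (Eventually.of_forall (capDensity_minus W V)))

theorem symCapacity_minus_le (W V : BinaryChannel.{u}) :
    (minus W V).symCapacity ≤ W.symCapacity * V.tvDist := by
  rw [symCapacity_minus, symCapacity_eq_integral W, tvDist,
    ← integral_prod_mul (fun y => capDensity (W.prob 0 y) (W.prob 1 y))
      (fun z => |V.prob 0 z - V.prob 1 z| / 2)]
  exact integral_mono (integrable_minusDensity W V)
    (W.integrable_capDensity.mul_prod V.integrable_tv) fun p =>
      capDensity_minus_le (W.prob_nonneg _ _) (W.prob_nonneg _ _) (V.prob_nonneg _ _)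
        (V.prob_nonneg _ _)

theorem integral_prod_prod_count {Y Z : Type u} [MeasurableSpace Y] [MeasurableSpace Z]
    (μ : Measure Y) (ν : Measure Z) [SigmaFinite μ] [SigmaFinite ν] {f : Y × Z × ZMod 2 → ℝ}
    (hf : Integrable f (μ.prod (ν.prod Measure.count))) :
    ∫ p, f p ∂(μ.prod (ν.prod Measure.count)) =
      ∫ p : Y × Z, (f (p.1, p.2, 0) + f (p.1, p.2, 1)) ∂(μ.prod ν) := by
  have hmp := measurePreserving_prodAssoc μ ν (Measure.count : Measure (ZMod 2))
  rw [← hmp.integral_comp' f, integral_prod]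
  · refine integral_congr_ae (Eventually.of_forall fun p => ?_)
    simp only
    rw [integral_fintype Integrable.of_finite, sum_zmod_two]
    simp
    rfl
  · exact (hmp.integrable_comp_emb MeasurableEquiv.prodAssoc.measurableEmbedding).2 hf

theorem symCapacity_minus_add_plus (W V : BinaryChannel.{u}) :
    (minus W V).symCapacity + (plus W V).symCapacity = W.symCapacity + V.symCapacity := by
  have hp : Integrable (fun p : W.Y × V.Y × ZMod 2 =>
      capDensity ((plus W V).prob 0 p) ((plus W V).prob 1 p))
      (W.ref.prod (V.ref.prod Measure.count)) := (plus W V).integrable_capDensity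
  have hplus : (plus W V).symCapacity = ∫ p : W.Y × V.Y,
      (capDensity ((1 / 2 : ℝ) * W.prob 0 p.1 * V.prob 0 p.2)
        ((1 / 2 : ℝ) * W.prob 1 p.1 * V.prob 1 p.2) +
      capDensity ((1 / 2 : ℝ) * W.prob 1 p.1 * V.prob 0 p.2)
        ((1 / 2 : ℝ) * W.prob 0 p.1 * V.prob 1 p.2)) ∂(W.ref.prod V.ref) := by
    rw [symCapacity_eq_integral]
    refine (integral_prod_prod_count W.ref V.ref hp).trans ?_
    refine integral_congr_ae (Eventually.of_forall fun p => ?_)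
    simp only [plus, add_zero, zero_add, show (1 + 1 : ZMod 2) = 0 from by decide]
  -- The right-hand side of the pointwise chain rule, with its integral.
  have hW := W.integrable_capDensity.mul_prod V.integrable_mean
  have hV := W.integrable_mean.mul_prod V.integrable_capDensity
  have hsum : W.symCapacity + V.symCapacity = ∫ p : W.Y × V.Y,
      (capDensity (W.prob 0 p.1) (W.prob 1 p.1) * ((V.prob 0 p.2 + V.prob 1 p.2) / 2) +
      (W.prob 0 p.1 + W.prob 1 p.1) / 2 * capDensity (V.prob 0 p.2) (V.prob 1 p.2))
      ∂(W.ref.prod V.ref) := by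
    rw [integral_add hW hV,
      integral_prod_mul (fun y => capDensity (W.prob 0 y) (W.prob 1 y))
        (fun z => (V.prob 0 z + V.prob 1 z) / 2),
      integral_prod_mul (fun y => (W.prob 0 y + W.prob 1 y) / 2)
        (fun z => capDensity (V.prob 0 z) (V.prob 1 z)),
      W.integral_mean, V.integral_mean, ← W.symCapacity_eq_integral, ← V.symCapacity_eq_integral,
      mul_one, one_mul]
  have hsub : ∫ p : W.Y × V.Y,
      (capDensity (W.prob 0 p.1) (W.prob 1 p.1) * ((V.prob 0 p.2 + V.prob 1 p.2) / 2) +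
      (W.prob 0 p.1 + W.prob 1 p.1) / 2 * capDensity (V.prob 0 p.2) (V.prob 1 p.2) -
      minusDensity W V p) ∂(W.ref.prod V.ref) =
      W.symCapacity + V.symCapacity - (minus W V).symCapacity := by
    rw [hsum, symCapacity_minus]
    exact integral_sub (hW.add hV) (integrable_minusDensity W V)
  -- Subtracting the densities avoids a separate integrability proof for `(W,V)⁺`.
  rw [← eq_sub_iff_add_eq', ← hsub, hplus]
  refine integral_congr_ae (Eventually.of_forall fun p => ?_)
  simp only
  rw [eq_sub_iff_add_eq']
  exact capDensity_chain (W.prob_nonneg _ _) (W.prob_nonneg _ _) (V.prob_nonneg _ _)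
    (V.prob_nonneg _ _)

/-! ### Limits along slow polarization -/

theorem slowL_add_slowR (W : BinaryChannel.{u}) (n : ℕ) :
    (W.slowL n).symCapacity + (W.slowR n).symCapacity = 2 * W.symCapacity := by
  induction n with
  | zero => exact (two_mul _).symm
  | succ n ih => exact (symCapacity_minus_add_plus _ _).trans ih

theorem antitone_slowL (W : BinaryChannel.{u}) :
    Antitone fun n => (W.slowL n).symCapacity := by
  refine antitone_nat_of_succ_le fun n => ?_
  exact (symCapacity_minus_le (W.slowL n) (W.slowR n)).trans
    (mul_le_of_le_one_right (symCapacity_nonneg _) (tvDist_le_one _))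

theorem exists_tendsto_slow (W : BinaryChannel.{u}) :
    ∃ l r : ℝ, Tendsto (fun n => (W.slowL n).symCapacity) atTop (𝓝 l) ∧
      Tendsto (fun n => (W.slowR n).symCapacity) atTop (𝓝 r) ∧
      0 ≤ l ∧ r ≤ 1 ∧ l + r = 2 * W.symCapacity ∧ (l = 0 ∨ r = 1) := by
  have hL := tendsto_atTop_ciInf W.antitone_slowL
    ⟨0, by rintro _ ⟨n, rfl⟩; exact symCapacity_nonneg _⟩
  set l := ⨅ n, (W.slowL n).symCapacity
  have hR : Tendsto (fun n => (W.slowR n).symCapacity) atTop (𝓝 (2 * W.symCapacity - l)) :=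
    (hL.const_sub _).congr fun n => by rw [← W.slowL_add_slowR n]; ring
  have hl : 0 ≤ l := ge_of_tendsto' hL fun n => symCapacity_nonneg _
  have hr : 2 * W.symCapacity - l ≤ 1 := le_of_tendsto' hR fun n => symCapacity_le_one _
  refine ⟨l, _, hL, hR, hl, hr, by ring, ?_⟩
  set r := 2 * W.symCapacity - l
  have hlim := le_of_tendsto_of_tendsto' (hL.comp (tendsto_add_atTop_nat 1))
    (hL.mul (((hR.const_sub 1).pow 2).const_mul (Real.log 2 ^ 2 / 2) |>.const_sub 1)) fun n =>
    (symCapacity_minus_le (W.slowL n) (W.slowR n)).trans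
      (mul_le_mul_of_nonneg_left (tvDist_le _) (symCapacity_nonneg _))
  have h2 : 0 < Real.log 2 ^ 2 / 2 := by have := Real.log_pos one_lt_two; positivity
  have h0 : Real.log 2 ^ 2 / 2 * (l * (1 - r) ^ 2) ≤ 0 := by linarith
  have h1 : l * (1 - r) ^ 2 = 0 :=
    le_antisymm (nonpos_of_mul_nonpos_right h0 h2) (by positivity)
  rcases mul_eq_zero.1 h1 with h | h
  · exact Or.inl h
  · right
    have := pow_eq_zero_iff two_ne_zero |>.1 h
    linarith

end BinaryChannel

theorem proposition1 (W : BinaryChannel.{u}) :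
    (1 / 2 ≤ W.symCapacity →
      Tendsto (fun n : ℕ => (W.slowL n).symCapacity) atTop (𝓝 (2 * W.symCapacity - 1)) ∧
      Tendsto (fun n : ℕ => (W.slowR n).symCapacity) atTop (𝓝 1)) ∧
    (W.symCapacity ≤ 1 / 2 →
      Tendsto (fun n : ℕ => (W.slowL n).symCapacity) atTop (𝓝 0) ∧
      Tendsto (fun n : ℕ => (W.slowR n).symCapacity) atTop (𝓝 (2 * W.symCapacity))) := by
  obtain ⟨l, r, hL, hR, hl, hr, hsum, h⟩ := W.exists_tendsto_slow
  constructor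
  · intro hI
    have hr1 : r = 1 := by rcases h with h | h <;> linarith
    have hl1 : l = 2 * W.symCapacity - 1 := by linarith
    exact ⟨hl1 ▸ hL, hr1 ▸ hR⟩
  · intro hI
    have hl0 : l = 0 := by rcases h with h | h <;> linarith
    have hr0 : r = 2 * W.symCapacity := by linarith
    exact ⟨hl0 ▸ hL, hr0 ▸ hR⟩
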